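/- Notation. Let $\mathfrak H$ be the upper half-plane, $q=e^{2\pi i z}$, $\mathbb L=\log|q|=\pi i(z-\overline z)=-2\pi\,\mathrm{Im}\,z$, and $\partial_r=(z-\overline z)\frac{\partial}{\partial z}+r$, $\overline\partial_s=(\overline z-z)\frac{\partial}{\partial\overline z}+s$. Let $M^!_k$ be the space of weakly holomorphic modular forms $f=\sum_{m\ge -N}a_m(f)q^m$ of weight $k$ for $\Gamma=\mathrm{SL}_2(\mathbb Z)$, and $S_k\subset M_k^!$ the space of holomorphic cusp forms. Let $\mathcal M^!_{r,s}$ be the space of real analytic $F:\mathfrak H\to\mathbb C$ with $F(\gamma z)=(cz+d)^r(c\overline z+d)^sF(z)$ for all $\gamma=\begin{pmatrix}a&b\\c&d\end{pmatrix}\in\Gamma$ that have an expansion $\sum_{|k|\le M}\mathbb L^k\sum_{m,m'\ge -N}a^{(k)}_{m,m'}q^m\overline q^{m'}$. On $\mathfrak{H}$ the operator $\partial$ (resp. $\overline\partial$) acts on $\mathcal M^!_{r,s}$ as $\partial_r$ (resp. $\overline\partial_s$). Fix an integer $n\ge 0$. For $f\in M^!_{n+2}$, $k\ge0$ and $r+s=n$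 with $r,s\ge0$ put $$f^{(k)}=\sum_{m\ne0}\frac{a_m(f)}{(2m)^k}q^m,\qquad R_{r,s}(f)=(-1)^r\binom nr\sum_{k=s}^n\binom r{k-s}(-1)^k\frac{k!}{\mathbb L^k}f^{(k+1)}.$$ Let $V_n$ be the space of homogeneous polynomials of degree $n$ in $X,Y$ with the right action $(X,Y)|_\gamma=(aX+bY,cX+dY)$. For $f\in M^!_{n+2}$ let $[C^f]\in H^1(\Gamma;V_n\otimes\mathbb C)$ be the class of the cocycle $C^f_\gamma=F_f(\gamma\tau)|_\gamma-F_f(\tau)$, where $F_f(\tau)=\int_\tau^{\tau_0}(2\pi i)^{n+1}f(w)(X-wY)^n\,dw$ (it does not depend on $\tau$ and $\tau_0$). Let $F_\infty$ be the involution of $H^1(\Gamma;V_n\otimes\mathbb{C})$ given by conjugation by $\epsilon=\mathrm{diag}(1,-1)$ on $\Gamma$ and $(X,Y)\mapsto(X,-Y)$ on $V_n$. The single-valued image $\mathbf s(f)$ of $f$ is the form in $M^!_{n+2}$ with $[C^{\mathbf s(f)}]=F_\infty[C^f]$ and with pole of order at most $\dim S_{n+2}$ at the cusp. The real analytic cusp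 forms attached to $f$ (for example, to a normalised cuspidal Hecke eigenform $f$) are functions $\mathcal H(f)_{r,s}\in\mathcal M^!_{r,s}$, for $r+s=n$ and $r,s\ge0$, such that $\mathcal H(f)=\sum_{r+s=n}\mathcal H(f)_{r,s}(X-zY)^r(X-\overline zY)^s$ satisfies $$d\mathcal H(f)=\pi i\,f(z)(X-zY)^n\,dz+\pi i\,\overline{\mathbf s(f)(z)}\,(X-\overline zY)^n\,d\overline z.$$ Theorem. (1) Let $f\in M^!_{n+2}$, and let $\mathcal H(f)_{r,s}$ be real analytic cusp forms attached to $f$. There is a unique $\alpha_f\in\mathbb C$ such that, for all $r,s\ge0$ with $r+s=n$, $$\mathcal H(f)_{r,s}=\frac{a_0(f)}{n+1}\mathbb L+\alpha_f(-1)^r\binom nr\mathbb L^{-n}+R_{r,s}(f)-\overline{R_{s,r}(\mathbf s(f))}.$$ (2) More generally, let $f,g\in M^!_{n+2}$ and let $X_{r,s}\in\mathcal M^!_{r,s}$ ($r,s\ge0$, $r+s=n$) satisfy $\partial X_{r,s}=(r+1)X_{r+1,s-1}$ for $s\ge1$, $\overline\partial X_{r,s}=(s+1)X_{r-1,s+1}$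 for $r\ge1$, $\partial X_{n,0}=\mathbb Lf$ and $\overline\partial X_{0,n}=\mathbb L\overline g$. Then $a_0(f)=\overline{a_0(g)}$, and there is a unique $\alpha\in\mathbb C$ such that, for all $r,s\ge0$ with $r+s=n$, $$X_{r,s}=\frac{a_0(f)}{n+1}\mathbb L+\alpha(-1)^r\binom nr\mathbb L^{-n}+R_{r,s}(f)+\overline{R_{s,r}(g)}.$$ -/

import Mathlib

open UpperHalfPlane hiding I
open Complex

open scoped MatrixGroups ComplexConjugate

noncomputable section

namespace RealAnalyticModular

/-! ### Basic functions on the upper half-plane -/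

/-- `q = exp(2πiz)`. -/
def q (z : ℍ) : ℂ := Complex.exp (2 * (Real.pi : ℂ) * I * (z : ℂ))

/-- `𝕃 = log |q| = πi (z - z̄) = -2π Im z`. -/
def LL (z : ℍ) : ℂ := ((-(2 * Real.pi * z.im) : ℝ) : ℂ)

/-- The automorphy factor `cz + d` of `γ = (a b; c d)`. -/
def autFactor (γ : SL(2, ℤ)) (z : ℍ) : ℂ := ((γ 1 0 : ℤ) : ℂ) * (z : ℂ) + ((γ 1 1 : ℤ) : ℂ)

/-- `f(γz) = (cz+d)^r (cz̄+d)^s f(z)` for all `γ ∈ SL₂(ℤ)`. -/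
def IsModularOfWeights (r s : ℤ) (f : ℍ → ℂ) : Prop :=
  ∀ (γ : SL(2, ℤ)) (z : ℍ),
    f (γ • z) = autFactor γ z ^ r * (conj (autFactor γ z)) ^ s * f z

/-- The Wirtinger derivative `∂F/∂z = (∂F/∂x - i ∂F/∂y)/2`. -/
def dz (F : ℂ → ℂ) (z : ℂ) : ℂ := (fderiv ℝ F z 1 - I * fderiv ℝ F z I) / 2

/-- The Wirtinger derivative `∂F/∂z̄ = (∂F/∂x + i ∂F/∂y)/2`. -/
def dzbar (F : ℂ → ℂ) (z : ℂ) : ℂ := (fderiv ℝ F z 1 + I * fderiv ℝ F z I) / 2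

/-- `∂_r = (z - z̄) ∂/∂z + r`, on functions on the upper half-plane. -/
def del (r : ℤ) (f : ℍ → ℂ) (z : ℍ) : ℂ :=
  ((z : ℂ) - conj (z : ℂ)) * dz (f ∘ ofComplex) z + (r : ℂ) * f z

/-- `∂̄_s = (z̄ - z) ∂/∂z̄ + s`, on functions on the upper half-plane. -/
def delbar (s : ℤ) (f : ℍ → ℂ) (z : ℍ) : ℂ :=
  (conj (z : ℂ) - (z : ℂ)) * dzbar (f ∘ ofComplex) z + (s : ℂ) * f z

/-! ### The spaces `M_k^!` and `𝓜_{r,s}^!` -/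

/-- A weakly holomorphic modular form of weight `k` for `SL₂(ℤ)`: a holomorphic function on the
upper half-plane, modular of weight `k`, with a Laurent expansion `∑_{m ≥ -N} a_m q^m`.
The coefficients `a_m`, which are determined by the function, are part of the data. -/
structure WeaklyHolomorphicForm (k : ℤ) where
  toFun : ℍ → ℂ
  coeff : ℤ → ℂ
  holo : DifferentiableOn ℂ (toFun ∘ ofComplex) {z : ℂ | 0 < z.im}
  modular : ∀ (γ : SL(2, ℤ)) (z : ℍ), toFun (γ • z) = autFactor γ z ^ k * toFun z
  finite_pole : ∃ N : ℕ, ∀ m : ℤ, m < -(N : ℤ) → coeff m = 0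
  hasSum : ∀ z : ℍ, HasSum (fun m : ℤ => coeff m * q z ^ m) (toFun z)

/-- `f` belongs to `𝓜_{r,s}^!`: it is real analytic, modular of weights `(r,s)`, and admits an
expansion `∑_{|k| ≤ M} 𝕃^k ∑_{m,n ≥ -N} a^{(k)}_{m,n} q^m q̄^n`. -/
structure IsRealAnalyticModular (r s : ℤ) (f : ℍ → ℂ) : Prop where
  analytic : AnalyticOnNhd ℝ (f ∘ ofComplex) {z : ℂ | 0 < z.im}
  modular : IsModularOfWeights r s f
  expansion : ∃ (M N : ℕ) (a : ℤ → ℤ → ℤ → ℂ),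
    (∀ k m n : ℤ, (m < -(N : ℤ) ∨ n < -(N : ℤ)) → a k m n = 0) ∧
    ∀ z : ℍ,
      (∀ k ∈ Finset.Icc (-(M : ℤ)) (M : ℤ),
        Summable (fun p : ℤ × ℤ => a k p.1 p.2 * (q z ^ p.1 * conj (q z) ^ p.2))) ∧
      f z = ∑ k ∈ Finset.Icc (-(M : ℤ)) (M : ℤ),
        LL z ^ k * ∑' p : ℤ × ℤ, a k p.1 p.2 * (q z ^ p.1 * conj (q z) ^ p.2)

/-! ### The functions `f^{(k)}` and `R_{r,s}(f)` -/

/-- `f^{(k)} = ∑_{m ≠ 0} a_m(f) / (2m)^k q^m`. -/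
def iteratedPrimitive {w : ℤ} (f : WeaklyHolomorphicForm w) (k : ℕ) (z : ℍ) : ℂ :=
  ∑' m : ℤ, if m = 0 then 0 else f.coeff m / (2 * (m : ℂ)) ^ k * q z ^ m

/-- With `n = r + s`,
`R_{r,s}(f) = (-1)^r (n choose r) ∑_{k=s}^n (r choose k-s) (-1)^k k! 𝕃^{-k} f^{(k+1)}`. -/
def R {w : ℤ} (r s : ℕ) (f : WeaklyHolomorphicForm w) (z : ℍ) : ℂ :=
  (-1) ^ r * ((r + s).choose r : ℂ) *
    ∑ k ∈ Finset.Icc s (r + s),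
      (r.choose (k - s) : ℂ) * (-1) ^ k * ((k.factorial : ℂ) / LL z ^ k) *
        iteratedPrimitive f (k + 1) z

/-! ### Systems of modular primitives -/

/-- `(X_{r,s})_{r+s=n}` is a system of modular primitives with boundary data `f, g`:
`X_{r,s} ∈ 𝓜_{r,s}^!`, `∂X_{r,s} = (r+1) X_{r+1,s-1}` for `s ≥ 1`,
`∂̄X_{r,s} = (s+1) X_{r-1,s+1}` for `r ≥ 1`, `∂X_{n,0} = 𝕃 f` and `∂̄X_{0,n} = 𝕃 ḡ`. -/
structure IsModularPrimitiveSystem (n : ℕ) (f g : WeaklyHolomorphicForm ((n : ℤ) + 2))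
    (X : ℕ → ℕ → ℍ → ℂ) : Prop where
  mem : ∀ r s : ℕ, r + s = n → IsRealAnalyticModular r s (X r s)
  del_eq : ∀ r s : ℕ, r + (s + 1) = n → ∀ z : ℍ,
    del r (X r (s + 1)) z = ((r : ℂ) + 1) * X (r + 1) s z
  delbar_eq : ∀ r s : ℕ, (r + 1) + s = n → ∀ z : ℍ,
    delbar s (X (r + 1) s) z = ((s : ℂ) + 1) * X r (s + 1) z
  del_top : ∀ z : ℍ, del n (X n 0) z = LL z * f.toFun z
  delbar_bot : ∀ z : ℍ, delbar n (X 0 n) z = LL z * conj (g.toFun z)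

/-! ### The single-valued involution

Elements of `V_n ⊗ ℂ`, the homogeneous polynomials of degree `n` in `X, Y`, are written as
functions of `(X, Y) ∈ ℂ²`; the right action of `γ` is `P|γ (X, Y) = P(aX + bY, cX + dY)`. -/

/-- The homogeneous polynomial `∑_i c_i X^i Y^{n-i}`. -/
def homPoly (n : ℕ) (c : Fin (n + 1) → ℂ) (X Y : ℂ) : ℂ :=
  ∑ i : Fin (n + 1), c i * X ^ (i : ℕ) * Y ^ (n - (i : ℕ))

/-- The right action of `SL₂(ℤ)` on functions of `(X, Y)`. -/
def slash (P : ℂ → ℂ → ℂ) (γ : SL(2, ℤ)) (X Y : ℂ) : ℂ :=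
  P (((γ 0 0 : ℤ) : ℂ) * X + ((γ 0 1 : ℤ) : ℂ) * Y)
    (((γ 1 0 : ℤ) : ℂ) * X + ((γ 1 1 : ℤ) : ℂ) * Y)

/-- `F_f(τ) = ∫_τ^{τ₀} (2πi)^{n+1} f(w) (X - wY)^n dw`, integrated along the segment. -/
def eichlerIntegral (n : ℕ) (f : WeaklyHolomorphicForm ((n : ℤ) + 2)) (τ₀ τ : ℍ)
    (X Y : ℂ) : ℂ :=
  ∫ t in (0 : ℝ)..1,
    (fun w : ℂ => (2 * (Real.pi : ℂ) * I) ^ (n + 1) * f.toFun (ofComplex w) * (X - w * Y) ^ n)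
      ((τ : ℂ) + (t : ℂ) * ((τ₀ : ℂ) - (τ : ℂ))) * ((τ₀ : ℂ) - (τ : ℂ))

/-- The cocycle `C^f_γ = F_f(γτ)|γ - F_f(τ)`. It does not depend on `τ`, and its class in
`H¹(SL₂(ℤ); V_n ⊗ ℂ)` does not depend on `τ₀`; both are taken to be `i`. -/
def cocycle (n : ℕ) (f : WeaklyHolomorphicForm ((n : ℤ) + 2)) (γ : SL(2, ℤ)) (X Y : ℂ) : ℂ :=
  slash (eichlerIntegral n f UpperHalfPlane.I (γ • UpperHalfPlane.I)) γ X Y -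
    eichlerIntegral n f UpperHalfPlane.I UpperHalfPlane.I X Y

/-- Conjugation of `γ` by `ε = diag(1, -1)`. -/
def epsConj (γ : SL(2, ℤ)) : SL(2, ℤ) :=
  ⟨!![γ 0 0, -(γ 0 1); -(γ 1 0), γ 1 1], by
    have h := γ.det_coe
    rw [Matrix.det_fin_two] at h
    rw [Matrix.det_fin_two_of]
    linarith⟩

/-- The real Frobenius `F_∞` on cocycles: conjugation by `ε` on the group, `(X,Y) ↦ (X,-Y)` on
the coefficients. -/
def realFrobenius (C : SL(2, ℤ) → ℂ → ℂ → ℂ) (γ : SL(2, ℤ)) (X Y : ℂ) : ℂ :=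
  C (epsConj γ) X (-Y)

/-- `g = 𝐬(f)`: the image of `f` under the single-valued involution
`comp⁻¹ ∘ (F_∞ ⊗ id) ∘ comp` of `M_{n+2}^! / D^{n+1} M_{-n}^! ≅ H¹(SL₂(ℤ); V_n ⊗ ℂ)`,
`f ↦ [C^f]`, is the class of `g`, and `g` is the representative of its class
whose pole at the cusp has order at most `dim S_{n+2}`. -/
def IsSingleValuedImage (n : ℕ) (f g : WeaklyHolomorphicForm ((n : ℤ) + 2)) : Prop :=
  (∀ m : ℤ, m < -(Module.finrank ℂ (CuspForm 𝒮ℒ ((n : ℤ) + 2)) : ℤ) → g.coeff m = 0) ∧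
  ∃ c : Fin (n + 1) → ℂ, ∀ (γ : SL(2, ℤ)) (X Y : ℂ),
    cocycle n g γ X Y =
      realFrobenius (cocycle n f) γ X Y + (slash (homPoly n c) γ X Y - homPoly n c X Y)

/-! ### Real analytic cusp forms -/

/-- The section `∑_{r+s=n} H_{r,s}(z) (X - zY)^r (X - z̄Y)^s`, as a function of `z ∈ ℂ`
(used for `Im z > 0` only). -/
def vectorSection (n : ℕ) (H : ℕ → ℕ → ℍ → ℂ) (X Y : ℂ) (z : ℂ) : ℂ :=
  ∑ p ∈ Finset.HasAntidiagonal.antidiagonal n,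
    H p.1 p.2 (ofComplex z) * (X - z * Y) ^ p.1 * (X - conj z * Y) ^ p.2

/-- `(H_{r,s})_{r+s=n}` is the family of real analytic cusp forms `𝓗(f)_{r,s}`, where `sf = 𝐬(f)`:
`H_{r,s} ∈ 𝓜_{r,s}^!`, and `𝓗 = ∑ H_{r,s} (X - zY)^r (X - z̄Y)^s` satisfies
`d𝓗 = πi f(z) (X - zY)^n dz + πi conj(sf(z)) (X - z̄Y)^n dz̄`. -/
structure IsRealAnalyticCuspForm (n : ℕ) (f sf : WeaklyHolomorphicForm ((n : ℤ) + 2))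
    (H : ℕ → ℕ → ℍ → ℂ) : Prop where
  isImage : IsSingleValuedImage n f sf
  mem : ∀ r s : ℕ, r + s = n → IsRealAnalyticModular r s (H r s)
  dz_eq : ∀ (X Y : ℂ) (z : ℍ), dz (vectorSection n H X Y) z =
    (Real.pi : ℂ) * I * f.toFun z * (X - (z : ℂ) * Y) ^ n
  dzbar_eq : ∀ (X Y : ℂ) (z : ℍ), dzbar (vectorSection n H X Y) z =
    (Real.pi : ℂ) * I * conj (sf.toFun z) * (X - conj (z : ℂ) * Y) ^ n

end RealAnalyticModular

end

noncomputable section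

namespace RealAnalyticModular

/-! ### Wirtinger derivatives -/

/-! Put u = X - zY and v = X - z̄Y. Since -(z - z̄)Y = u - v, the raising and lowering equations for
a family (H_{r,s}) telescope into one equation for its section S = ∑ H_{r,s} u^r v^s: if the
boundary data are 𝕃F and 𝕃G, then dS = πi F u^n dz - πi G v^n dz̄
(`IsPrimitiveSystem.hasWirtingerAt_vectorSection`). Both parts of the theorem are thus one statement
about dS, with a sign ε in front of ḡ that is -1 in part (1) and 1 in part (2)
(`coeff_zero_eq_and_existsUnique`).

Three explicit families solve such systems: 𝕃 itself, with data F = G = n + 1; R_{r,s}(f), with data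
f - a_0(f) and 0 (`isPrimitiveSystem_R`); and the conjugates of R_{s,r}(g). Subtracting the right
combination from H leaves a translation-invariant family whose section satisfies dS = e v^n dz̄,
where e = πi (a_0(f) - ε conj a_0(g)).

Set Y = 1. With c = e/(n+1), the function S + c (X - z̄)^{n+1} does not depend on z. Translating z
and X together by 1 shows that it is a 1-periodic polynomial in X, hence constant. Its coefficient
of X^{n+1} is c, so e = 0, which is the relation between the constant terms. What remains is a
constant section, and the binomial expansion of (z - z̄)^n = (v - u)^n turns it into the family α
(-1)^r (n choose r) 𝕃^{-n} (`exists_eq_mul_LL_zpow_of_periodic`).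

Modularity enters through z ↦ z + 1 and, to settle a sign for odd n, through -1. -/

/-- The real-linear form `a dz + b dz̄`. -/
def wirtingerForm (a b : ℂ) : ℂ →L[ℝ] ℂ :=
  a • ContinuousLinearMap.id ℝ ℂ + b • (conjCLE : ℂ →L[ℝ] ℂ)

@[simp] lemma wirtingerForm_apply (a b w : ℂ) : wirtingerForm a b w = a * w + b * conj w := by
  simp [wirtingerForm]

/-- `F` is real differentiable at `z` with `dF = a dz + b dz̄`. -/
def HasWirtingerAt (F : ℂ → ℂ) (a b z : ℂ) : Prop :=
  HasFDerivAt F (wirtingerForm a b) z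

namespace HasWirtingerAt

variable {F G : ℂ → ℂ} {a b a' b' z : ℂ}

lemma dz_eq (h : HasWirtingerAt F a b z) : dz F z = a := by
  have hI : I * I = -1 := I_mul_I
  simp only [dz, HasFDerivAt.fderiv h, wirtingerForm_apply, map_one, conj_I]
  linear_combination (-a / 2 + b / 2) * hI

lemma dzbar_eq (h : HasWirtingerAt F a b z) : dzbar F z = b := by
  have hI : I * I = -1 := I_mul_I
  simp only [dzbar, HasFDerivAt.fderiv h, wirtingerForm_apply, map_one, conj_I]
  linear_combination (a / 2 - b / 2) * hI

lemma congr_deriv (h : HasWirtingerAt F a b z) (ha : a = a') (hb : b = b') :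
    HasWirtingerAt F a' b' z := ha ▸ hb ▸ h

lemma add (hF : HasWirtingerAt F a b z) (hG : HasWirtingerAt G a' b' z) :
    HasWirtingerAt (fun w => F w + G w) (a + a') (b + b') z := by
  refine (HasFDerivAt.add hF hG).congr_fderiv ?_
  refine ContinuousLinearMap.ext fun w => ?_
  simp
  ring

lemma mul (hF : HasWirtingerAt F a b z) (hG : HasWirtingerAt G a' b' z) :
    HasWirtingerAt (fun w => F w * G w) (F z * a' + G z * a) (F z * b' + G z * b) z := by
  refine (HasFDerivAt.mul hF hG).congr_fderiv ?_
  refine ContinuousLinearMap.ext fun w => ?_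
  simp
  ring

lemma const (c : ℂ) : HasWirtingerAt (fun _ => c) 0 0 z := by
  refine (hasFDerivAt_const c z).congr_fderiv ?_
  exact ContinuousLinearMap.ext fun w => by simp

lemma const_mul (c : ℂ) (hF : HasWirtingerAt F a b z) :
    HasWirtingerAt (fun w => c * F w) (c * a) (c * b) z :=
  ((const c).mul hF).congr_deriv (by ring) (by ring)

lemma sub (hF : HasWirtingerAt F a b z) (hG : HasWirtingerAt G a' b' z) :
    HasWirtingerAt (fun w => F w - G w) (a - a') (b - b') z := by
  refine (HasFDerivAt.sub hF hG).congr_fderiv ?_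
  refine ContinuousLinearMap.ext fun w => ?_
  simp
  ring

lemma sum {ι : Type*} (s : Finset ι) {F : ι → ℂ → ℂ} {a b : ι → ℂ}
    (h : ∀ i ∈ s, HasWirtingerAt (F i) (a i) (b i) z) :
    HasWirtingerAt (fun w => ∑ i ∈ s, F i w) (∑ i ∈ s, a i) (∑ i ∈ s, b i) z := by
  classical
  induction s using Finset.induction_on with
  | empty => simpa using const 0
  | insert i s hi ih =>
    simp only [Finset.sum_insert hi]
    exact (h i (Finset.mem_insert_self i s)).add
      (ih fun j hj => h j (Finset.mem_insert_of_mem hj))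

lemma conjugate (hF : HasWirtingerAt F a b z) :
    HasWirtingerAt (fun w => conj (F w)) (conj b) (conj a) z := by
  refine ((conjCLE : ℂ →L[ℝ] ℂ).hasFDerivAt.comp z hF).congr_fderiv ?_
  refine ContinuousLinearMap.ext fun w => ?_
  simp
  ring

lemma of_hasDerivAt {F : ℂ → ℂ} (h : HasDerivAt F a z) : HasWirtingerAt F a 0 z := by
  refine (h.hasFDerivAt.restrictScalars ℝ).congr_fderiv ?_
  exact ContinuousLinearMap.ext fun w => by simp [mul_comm]

lemma comp_hasDerivAt {g : ℂ → ℂ} {g' : ℂ} (hg : HasDerivAt g g' (F z))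
    (hF : HasWirtingerAt F a b z) : HasWirtingerAt (fun w => g (F w)) (g' * a) (g' * b) z := by
  refine ((hg.hasFDerivAt.restrictScalars ℝ).comp z hF).congr_fderiv ?_
  refine ContinuousLinearMap.ext fun w => ?_
  simp
  ring

lemma pow (hF : HasWirtingerAt F a b z) (m : ℕ) :
    HasWirtingerAt (fun w => F w ^ m) (m * F z ^ (m - 1) * a) (m * F z ^ (m - 1) * b) z :=
  comp_hasDerivAt (g := fun x => x ^ m) (hasDerivAt_pow m (F z)) hF

lemma of_differentiableAt (h : DifferentiableAt ℝ F z) :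
    HasWirtingerAt F (dz F z) (dzbar F z) z := by
  refine h.hasFDerivAt.congr_fderiv ?_
  refine ContinuousLinearMap.ext fun w => ?_
  have hw : fderiv ℝ F z w = w.re * fderiv ℝ F z 1 + w.im * fderiv ℝ F z I := by
    conv_lhs => rw [show w = w.re • (1 : ℂ) + w.im • I by simp]
    rw [map_add, map_smul, map_smul, real_smul, real_smul]
  have h1 : w + (starRingEnd ℂ) w = 2 * w.re := by rw [add_conj]; push_cast; ring
  have h2 : w - (starRingEnd ℂ) w = 2 * w.im * I := by rw [sub_conj]; push_cast; ring
  rw [hw, wirtingerForm_apply, dz, dzbar]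
  linear_combination (-(fderiv ℝ F z 1) / 2) * h1 + (I * fderiv ℝ F z I / 2) * h2 +
    (w.im * fderiv ℝ F z I) * I_mul_I

lemma congr_of_eventuallyEq (h : HasWirtingerAt F a b z) (hG : G =ᶠ[nhds z] F) :
    HasWirtingerAt G a b z := HasFDerivAt.congr_of_eventuallyEq h hG

end HasWirtingerAt

lemma eventually_im_pos (z : ℍ) : ∀ᶠ w : ℂ in nhds (z : ℂ), 0 < w.im :=
  (isOpen_lt continuous_const Complex.continuous_im).mem_nhds z.im_pos

/-- A function on the upper half-plane with vanishing Wirtinger derivatives is constant. -/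
lemma eq_of_hasWirtingerAt_zero {F : ℂ → ℂ} (h : ∀ z : ℍ, HasWirtingerAt F 0 0 z) (z w : ℍ) :
    F z = F w := by
  have h0 : ∀ x ∈ {x : ℂ | 0 < x.im}, HasFDerivAt F (0 : ℂ →L[ℝ] ℂ) x := fun x hx => by
    refine HasFDerivAt.congr_fderiv (h ⟨x, hx⟩) ?_
    exact ContinuousLinearMap.ext fun w => by simp
  exact (isOpen_lt continuous_const Complex.continuous_im).is_const_of_fderiv_eq_zero (𝕜 := ℝ)
    (convex_halfSpace_im_gt 0).isPreconnected
    (fun x hx => (h0 x hx).differentiableAt.differentiableWithinAt)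
    (fun x hx => (h0 x hx).fderiv) z.im_pos w.im_pos

/-! ### The function `𝕃` -/

lemma LL_eq (z : ℍ) : LL z = Real.pi * I * ((z : ℂ) - conj (z : ℂ)) := by
  rw [LL, sub_conj, coe_im]
  push_cast
  linear_combination (-(2 * Real.pi * (z.im : ℂ))) * I_mul_I

lemma LL_ne_zero (z : ℍ) : LL z ≠ 0 := by
  rw [LL, Complex.ofReal_ne_zero]
  have := mul_pos Real.pi_pos z.im_pos
  linarith

lemma conj_LL (z : ℍ) : conj (LL z) = LL z := conj_ofReal _

lemma sub_conj_ne_zero (z : ℍ) : (z : ℂ) - conj (z : ℂ) ≠ 0 := fun h =>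
  LL_ne_zero z (by rw [LL_eq, h, mul_zero])

lemma hasWirtingerAt_LL (z : ℍ) :
    HasWirtingerAt (LL ∘ ofComplex) (Real.pi * I) (-(Real.pi * I)) z := by
  have hid : HasWirtingerAt (fun w => w) 1 0 (z : ℂ) := .of_hasDerivAt (hasDerivAt_id _)
  refine (((hid.sub hid.conjugate).const_mul (Real.pi * I)).congr_deriv
    (by simp) (by simp)).congr_of_eventuallyEq ?_
  filter_upwards [eventually_im_pos z] with w hw
  simp [LL_eq, ofComplex_apply_of_im_pos hw]

/-! ### Differentiation of `f^{(k)}` -/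

variable {w : ℤ}

lemma norm_q (z : ℍ) : ‖q z‖ = Real.exp (-2 * Real.pi * z.im) := by
  rw [q, norm_exp]
  congr 1
  simp

lemma summable_norm_coeff (f : WeaklyHolomorphicForm w) (z : ℍ) :
    Summable fun m : ℤ => ‖f.coeff m‖ * Real.exp (-2 * Real.pi * m * z.im) := by
  refine (f.hasSum z).summable.norm.congr fun m => ?_
  rw [norm_mul, norm_zpow, norm_q, ← Real.rpow_intCast, ← Real.exp_mul]
  congr 2
  ring

lemma q_ofComplex_zpow {x : ℂ} (hx : 0 < x.im) (m : ℤ) :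
    q (ofComplex x) ^ m = cexp (2 * Real.pi * I * m * x) := by
  rw [ofComplex_apply_of_im_pos hx, q, ← Complex.exp_int_mul]
  congr 1
  change (m : ℂ) * (2 * Real.pi * I * x) = _
  ring

/-- On a horizontal strip the terms with m ≥ 0 are largest at the bottom edge and those with m ≤ 0
at the top edge; the sum of both values bounds either kind. -/
lemma norm_cexp_le {ε B : ℝ} {x : ℂ} (h1 : ε < x.im) (h2 : x.im < B) (m : ℤ) :
    ‖cexp (2 * Real.pi * I * m * x)‖ ≤
      Real.exp (-2 * Real.pi * m * ε) + Real.exp (-2 * Real.pi * m * B) := by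
  have hre : (2 * Real.pi * I * m * x).re = -2 * Real.pi * m * x.im := by
    simp [mul_assoc]
  rw [norm_exp, hre]
  rcases le_total 0 m with hm | hm
  · have hm' : (0 : ℝ) ≤ m := by exact_mod_cast hm
    have h : -2 * Real.pi * m * x.im ≤ -2 * Real.pi * m * ε := by
      nlinarith [mul_le_mul_of_nonneg_left h1.le (mul_nonneg Real.pi_pos.le hm')]
    linarith [Real.exp_le_exp.2 h, Real.exp_pos (-2 * Real.pi * m * B)]
  · have hm' : (0 : ℝ) ≤ -m := by
      have : (m : ℝ) ≤ 0 := by exact_mod_cast hm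
      linarith
    have h : -2 * Real.pi * m * x.im ≤ -2 * Real.pi * m * B := by
      nlinarith [mul_le_mul_of_nonneg_left h2.le (mul_nonneg Real.pi_pos.le hm')]
    linarith [Real.exp_le_exp.2 h, Real.exp_pos (-2 * Real.pi * m * ε)]

lemma norm_primitive_coeff_le {m : ℤ} (c : ℂ) (k : ℕ) :
    ‖if m = 0 then 0 else c / (2 * (m : ℂ)) ^ k‖ ≤ ‖c‖ := by
  split_ifs with hm
  · simp
  · rw [norm_div, norm_pow]
    refine div_le_self (norm_nonneg _) (one_le_pow₀ ?_)
    rw [norm_mul, norm_intCast]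
    have h : (1 : ℝ) ≤ |(m : ℝ)| := by exact_mod_cast Int.one_le_abs hm
    have h2 : ‖(2 : ℂ)‖ = 2 := by simp
    rw [h2]
    linarith

lemma iteratedPrimitive_ofComplex (f : WeaklyHolomorphicForm w) (k : ℕ) {x : ℂ} (hx : 0 < x.im) :
    iteratedPrimitive f k (ofComplex x) =
      ∑' m : ℤ, (if m = 0 then 0 else f.coeff m / (2 * (m : ℂ)) ^ k) *
        cexp (2 * Real.pi * I * m * x) := by
  refine tsum_congr fun m => ?_
  rw [q_ofComplex_zpow hx, ite_mul, zero_mul]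

/-- Termwise, 2πi m / (2m)^{k+1} = πi / (2m)^k. Differentiating the series is legitimate because it
is dominated on a strip around z by the absolutely convergent expansions of f at iε and iB. -/
lemma hasDerivAt_iteratedPrimitive (f : WeaklyHolomorphicForm w) (k : ℕ) (z : ℍ) :
    HasDerivAt (iteratedPrimitive f (k + 1) ∘ ofComplex)
      (Real.pi * I * iteratedPrimitive f k z) z := by
  set ε := z.im / 2 with hε
  set B := z.im + 1 with hB
  have hz := z.im_pos
  have hε0 : 0 < ε := by linarith
  have hB0 : 0 < B := by linarith
  let t : Set ℂ := {x | ε < x.im} ∩ {x | x.im < B}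
  have hzt : (z : ℂ) ∈ t := ⟨by change ε < z.im; linarith, by change z.im < B; linarith⟩
  have htopen : IsOpen t := (isOpen_lt continuous_const Complex.continuous_im).inter
    (isOpen_lt Complex.continuous_im continuous_const)
  have htconn : IsPreconnected t :=
    ((convex_halfSpace_im_gt ε).inter (convex_halfSpace_im_lt B)).isPreconnected
  have hu : Summable fun m : ℤ => ‖f.coeff m‖ *
      (Real.exp (-2 * Real.pi * m * ε) + Real.exp (-2 * Real.pi * m * B)) := by
    have h1 := summable_norm_coeff f (⟨⟨0, ε⟩, hε0⟩ : ℍ)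
    have h2 := summable_norm_coeff f (⟨⟨0, B⟩, hB0⟩ : ℍ)
    exact (h1.add h2).congr fun m => (mul_add _ _ _).symm
  have hbound : ∀ (j : ℕ) (m : ℤ), ∀ x ∈ t,
      ‖(if m = 0 then 0 else f.coeff m / (2 * (m : ℂ)) ^ j) * cexp (2 * Real.pi * I * m * x)‖ ≤
        ‖f.coeff m‖ * (Real.exp (-2 * Real.pi * m * ε) + Real.exp (-2 * Real.pi * m * B)) :=
    fun j m x hx => by
      rw [norm_mul]
      exact mul_le_mul (norm_primitive_coeff_le _ j) (norm_cexp_le hx.1 hx.2 m) (norm_nonneg _)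
        (norm_nonneg _)
  have key := hasDerivAt_tsum_of_isPreconnected
    (g := fun (m : ℤ) x => (if m = 0 then 0 else f.coeff m / (2 * (m : ℂ)) ^ (k + 1)) *
      cexp (2 * Real.pi * I * m * x))
    (g' := fun (m : ℤ) x => Real.pi * I * ((if m = 0 then 0 else f.coeff m / (2 * (m : ℂ)) ^ k) *
      cexp (2 * Real.pi * I * m * x)))
    (hu.mul_left ‖(Real.pi * I : ℂ)‖) htopen htconn
    (fun m x _ => by
      have h := ((((hasDerivAt_id x).const_mul (2 * Real.pi * I * m)).cexp).const_mul
        (if m = 0 then 0 else f.coeff m / (2 * (m : ℂ)) ^ (k + 1)))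
      refine h.congr_deriv ?_
      split_ifs with hm
      · simp
      · have : (m : ℂ) ≠ 0 := by exact_mod_cast hm
        simp only [id, pow_succ]
        field_simp)
    (fun m x hx => by
      rw [norm_mul]
      exact mul_le_mul_of_nonneg_left (hbound k m x hx) (norm_nonneg _))
    hzt (Summable.of_norm_bounded hu fun m => hbound (k + 1) m z hzt) hzt
  rw [tsum_mul_left, ← iteratedPrimitive_ofComplex f k z.im_pos, ofComplex_apply] at key
  refine key.congr_of_eventuallyEq ?_
  filter_upwards [eventually_im_pos z] with x hx
  exact iteratedPrimitive_ofComplex f (k + 1) hx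

lemma iteratedPrimitive_zero (f : WeaklyHolomorphicForm w) (z : ℍ) :
    iteratedPrimitive f 0 z = f.toFun z - f.coeff 0 := by
  have h := (f.hasSum z).update 0 0
  simp only [zpow_zero, mul_one] at h
  rw [iteratedPrimitive, show f.toFun z - f.coeff 0 = 0 - f.coeff 0 + f.toFun z by ring,
    ← h.tsum_eq]
  refine tsum_congr fun m => ?_
  by_cases hm : m = 0
  · simp [hm]
  · simp [hm]

/-! ### Invariance under translation -/

lemma q_vadd_one (z : ℍ) : q ((1 : ℝ) +ᵥ z) = q z := by
  rw [q, q, coe_vadd, ofReal_one, mul_add, mul_one, Complex.exp_add, exp_two_pi_mul_I, one_mul]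

lemma iteratedPrimitive_vadd_one (f : WeaklyHolomorphicForm w) (k : ℕ) (z : ℍ) :
    iteratedPrimitive f k ((1 : ℝ) +ᵥ z) = iteratedPrimitive f k z := by
  simp only [iteratedPrimitive, q_vadd_one]

lemma LL_vadd_one (z : ℍ) : LL ((1 : ℝ) +ᵥ z) = LL z := by
  simp [LL]

lemma R_vadd_one (r s : ℕ) (f : WeaklyHolomorphicForm w) (z : ℍ) :
    R r s f ((1 : ℝ) +ᵥ z) = R r s f z := by
  simp only [R, LL_vadd_one, iteratedPrimitive_vadd_one]

lemma IsModularOfWeights.vadd_one {r s : ℤ} {F : ℍ → ℂ} (h : IsModularOfWeights r s F) (z : ℍ) :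
    F ((1 : ℝ) +ᵥ z) = F z := by
  have := h ModularGroup.T z
  rw [UpperHalfPlane.modular_T_smul] at this
  rw [this]
  simp [autFactor, ModularGroup.T]

/-- A form that vanishes identically has vanishing constant term. -/
lemma coeff_zero_eq_zero {f : WeaklyHolomorphicForm w} (hf : ∀ z, f.toFun z = 0) :
    f.coeff 0 = 0 := by
  -- If f = 0, then f^{(1)} has derivative -πi a_0, so f^{(1)} + πi a_0 z is constant. As f^{(1)} is
  -- 1-periodic, comparing the values at i + 1 and i gives a_0 = 0.
  have h : ∀ z : ℍ, HasWirtingerAt (fun x => (iteratedPrimitive f 1 ∘ ofComplex) x +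
      Real.pi * I * f.coeff 0 * x) 0 0 z := fun z => by
    refine .congr_deriv (.of_hasDerivAt ((hasDerivAt_iteratedPrimitive f 0 z).add
      ((hasDerivAt_id _).const_mul _))) ?_ rfl
    rw [iteratedPrimitive_zero, hf]
    ring
  have h1 := eq_of_hasWirtingerAt_zero h ((1 : ℝ) +ᵥ UpperHalfPlane.I) UpperHalfPlane.I
  simp only [Function.comp_apply, ofComplex_apply, iteratedPrimitive_vadd_one] at h1
  rw [coe_vadd, ofReal_one] at h1
  have h2 : (Real.pi * I : ℂ) * f.coeff 0 = 0 := by linear_combination h1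
  simpa [Real.pi_ne_zero] using h2

/-- The matrix -1 acts trivially on the half-plane, but its automorphy factor is (-1)^{n+2} = -1. -/
lemma toFun_eq_zero_of_odd {n : ℕ} (hn : Odd n) (f : WeaklyHolomorphicForm ((n : ℤ) + 2))
    (z : ℍ) : f.toFun z = 0 := by
  have h := f.modular (-1) z
  have ha : autFactor (-1) z = -1 := by simp [autFactor]
  have ho : Odd ((n : ℤ) + 2) := by
    obtain ⟨k, rfl⟩ := hn
    exact ⟨k + 1, by push_cast; ring⟩
  rw [ModularGroup.SL_neg_smul, one_smul, ha, ho.neg_one_zpow] at h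
  linear_combination h / 2

/-! ### Systems of primitives -/

/-- The equations of `IsModularPrimitiveSystem`, without modularity, with boundary data `F` and
`G`. -/
structure IsPrimitiveSystem (n : ℕ) (H : ℕ → ℕ → ℍ → ℂ) (F G : ℍ → ℂ) : Prop where
  differentiableAt : ∀ r s : ℕ, r + s = n → ∀ z : ℍ,
    DifferentiableAt ℝ (H r s ∘ ofComplex) (z : ℂ)
  del_eq : ∀ r s : ℕ, r + (s + 1) = n → ∀ z : ℍ,
    del r (H r (s + 1)) z = ((r : ℂ) + 1) * H (r + 1) s z
  delbar_eq : ∀ r s : ℕ, (r + 1) + s = n → ∀ z : ℍ,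
    delbar s (H (r + 1) s) z = ((s : ℂ) + 1) * H r (s + 1) z
  del_top : ∀ z : ℍ, del n (H n 0) z = LL z * F z
  delbar_bot : ∀ z : ℍ, delbar n (H 0 n) z = LL z * G z

/-- Here D stands for ∂_r H_{r,s}. The equation for D_{r,s+1} cancels it against the subtracted term
of index (r+1, s), so only the top term D_{n,0} survives. -/
lemma sum_antidiagonal_telescope {n : ℕ} {D H : ℕ → ℕ → ℂ} {F : ℂ} (u v : ℂ)
    (hD : ∀ r s : ℕ, r + (s + 1) = n → D r (s + 1) = ((r : ℂ) + 1) * H (r + 1) s)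
    (htop : D n 0 = F) :
    ∑ p ∈ Finset.HasAntidiagonal.antidiagonal n,
      (D p.1 p.2 * u ^ p.1 * v ^ p.2 - p.1 * H p.1 p.2 * u ^ (p.1 - 1) * v ^ (p.2 + 1)) =
        F * u ^ n := by
  rw [Finset.sum_sub_distrib]
  cases n with
  | zero => simp [htop]
  | succ n =>
    rw [Finset.Nat.sum_antidiagonal_succ', Finset.Nat.sum_antidiagonal_succ, htop]
    have : ∀ p ∈ Finset.HasAntidiagonal.antidiagonal n,
        D p.1 (p.2 + 1) * u ^ p.1 * v ^ (p.2 + 1) =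
          ((p.1 + 1 : ℕ) : ℂ) * H (p.1 + 1) p.2 * u ^ (p.1 + 1 - 1) * v ^ (p.2 + 1) := by
      intro p hp
      rw [Finset.HasAntidiagonal.mem_antidiagonal] at hp
      rw [hD p.1 p.2 (by omega)]
      simp
    rw [Finset.sum_congr rfl this]
    simp

lemma hasWirtingerAt_vectorSection_of_differentiableAt {n : ℕ} {H : ℕ → ℕ → ℍ → ℂ} {z : ℍ}
    (h : ∀ r s : ℕ, r + s = n → DifferentiableAt ℝ (H r s ∘ ofComplex) (z : ℂ)) (X Y : ℂ) :
    HasWirtingerAt (vectorSection n H X Y)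
      (∑ p ∈ Finset.HasAntidiagonal.antidiagonal n,
        (H p.1 p.2 z * (p.1 * (X - z * Y) ^ (p.1 - 1) * -Y) +
          (X - z * Y) ^ p.1 * dz (H p.1 p.2 ∘ ofComplex) z) * (X - conj (z : ℂ) * Y) ^ p.2)
      (∑ p ∈ Finset.HasAntidiagonal.antidiagonal n,
        (H p.1 p.2 z * (p.2 * (X - conj (z : ℂ) * Y) ^ (p.2 - 1) * -Y) +
          (X - conj (z : ℂ) * Y) ^ p.2 * dzbar (H p.1 p.2 ∘ ofComplex) z) *
            (X - z * Y) ^ p.1) z := by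
  have hid : HasWirtingerAt (fun w => w) 1 0 (z : ℂ) := .of_hasDerivAt (hasDerivAt_id _)
  have hu : HasWirtingerAt (fun w => X - w * Y) (-Y) 0 (z : ℂ) :=
    ((HasWirtingerAt.const X).sub (hid.mul (.const Y))).congr_deriv (by simp) (by simp)
  have hv : HasWirtingerAt (fun w => X - conj w * Y) 0 (-Y) (z : ℂ) :=
    ((HasWirtingerAt.const X).sub (hid.conjugate.mul (.const Y))).congr_deriv (by simp) (by simp)
  refine HasWirtingerAt.sum _ fun p hp =>
    (((HasWirtingerAt.of_differentiableAt (h p.1 p.2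
      (Finset.HasAntidiagonal.mem_antidiagonal.1 hp))).mul (hu.pow p.1)).mul
        (hv.pow p.2)).congr_deriv ?_ ?_
  · simp only [Function.comp_apply, ofComplex_apply]
    ring
  · simp only [Function.comp_apply, ofComplex_apply]
    ring

/-- After multiplication by z - z̄, the derivative of u^r contributes r u^{r-1}(u - v). Its u-part
completes (z - z̄)∂H to ∂_r H, and its v-part is the term that telescopes. The dz̄ component follows
with the indices exchanged, and gets a minus sign because ∂̄ carries z̄ - z. -/
lemma IsPrimitiveSystem.hasWirtingerAt_vectorSection {n : ℕ} {H : ℕ → ℕ → ℍ → ℂ} {F G : ℍ → ℂ}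
    (h : IsPrimitiveSystem n H F G) (X Y : ℂ) (z : ℍ) :
    HasWirtingerAt (vectorSection n H X Y) (Real.pi * I * F z * (X - (z : ℂ) * Y) ^ n)
      (-(Real.pi * I * G z * (X - conj (z : ℂ) * Y) ^ n)) z := by
  have hz := sub_conj_ne_zero z
  refine (hasWirtingerAt_vectorSection_of_differentiableAt
    (fun r s hrs => h.differentiableAt r s hrs z) X Y).congr_deriv ?_ ?_
  · have key := sum_antidiagonal_telescope (D := fun r s => del r (H r s) z)
      (H := fun r s => H r s z) (X - z * Y) (X - conj (z : ℂ) * Y)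
      (fun r s hrs => h.del_eq r s hrs z) (h.del_top z)
    apply mul_left_cancel₀ hz
    rw [LL_eq] at key
    rw [show ((z : ℂ) - conj (z : ℂ)) * (Real.pi * I * F z * (X - z * Y) ^ n) =
      Real.pi * I * (z - conj (z : ℂ)) * F z * (X - z * Y) ^ n by ring, ← key, Finset.mul_sum]
    refine Finset.sum_congr rfl fun p _ => ?_
    obtain ⟨r, s⟩ := p
    simp only [del, Int.cast_natCast]
    rcases r with _ | r
    · simp
      ring
    · simp only [Nat.add_sub_cancel, pow_succ]
      push_cast
      ring
  · have key := sum_antidiagonal_telescope (D := fun r s => delbar r (H s r) z)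
      (H := fun r s => H s r z) (X - conj (z : ℂ) * Y) (X - z * Y)
      (fun r s hrs => h.delbar_eq s r (by omega) z) (h.delbar_bot z)
    rw [← Finset.Nat.sum_antidiagonal_swap] at key
    apply mul_left_cancel₀ hz
    rw [LL_eq] at key
    rw [show ((z : ℂ) - conj (z : ℂ)) * -(Real.pi * I * G z * (X - conj (z : ℂ) * Y) ^ n) =
      -(Real.pi * I * (z - conj (z : ℂ)) * G z * (X - conj (z : ℂ) * Y) ^ n) by ring, ← key,
      Finset.mul_sum, ← Finset.sum_neg_distrib]
    refine Finset.sum_congr rfl fun p _ => ?_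
    obtain ⟨r, s⟩ := p
    simp only [delbar, Int.cast_natCast, Prod.swap]
    rcases s with _ | s
    · simp
      ring
    · simp only [Nat.add_sub_cancel, pow_succ]
      push_cast
      ring

lemma HasWirtingerAt.del_eq {F : ℍ → ℂ} {a b : ℂ} {z : ℍ}
    (h : HasWirtingerAt (F ∘ ofComplex) a b z) (r : ℤ) :
    del r F z = ((z : ℂ) - conj (z : ℂ)) * a + r * F z := by
  rw [del, h.dz_eq]

lemma HasWirtingerAt.delbar_eq {F : ℍ → ℂ} {a b : ℂ} {z : ℍ}
    (h : HasWirtingerAt (F ∘ ofComplex) a b z) (s : ℤ) :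
    delbar s F z = (conj (z : ℂ) - (z : ℂ)) * b + s * F z := by
  rw [delbar, h.dzbar_eq]

lemma del_conj {F : ℍ → ℂ} {z : ℍ} (h : DifferentiableAt ℝ (F ∘ ofComplex) z) (r : ℤ) :
    del r (fun w => conj (F w)) z = conj (delbar r F z) := by
  have hF := HasWirtingerAt.of_differentiableAt h
  rw [HasWirtingerAt.del_eq (F := fun w => conj (F w)) hF.conjugate, hF.delbar_eq]
  simp

lemma delbar_conj {F : ℍ → ℂ} {z : ℍ} (h : DifferentiableAt ℝ (F ∘ ofComplex) z) (s : ℤ) :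
    delbar s (fun w => conj (F w)) z = conj (del s F z) := by
  have hF := HasWirtingerAt.of_differentiableAt h
  rw [HasWirtingerAt.delbar_eq (F := fun w => conj (F w)) hF.conjugate, hF.del_eq]
  simp

/-- Complex conjugation exchanges the two indices and the two boundary data. -/
lemma IsPrimitiveSystem.conjugate {n : ℕ} {H : ℕ → ℕ → ℍ → ℂ} {F G : ℍ → ℂ}
    (h : IsPrimitiveSystem n H F G) :
    IsPrimitiveSystem n (fun r s z => conj (H s r z)) (fun z => conj (G z))
      (fun z => conj (F z)) where
  differentiableAt r s hrs z := HasFDerivAt.differentiableAt (HasWirtingerAt.conjugate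
    (.of_differentiableAt (h.differentiableAt s r (by omega) z)))
  del_eq r s hrs z := by
    rw [del_conj (h.differentiableAt _ _ (by omega) z), h.delbar_eq s r (by omega) z]
    simp
  delbar_eq r s hrs z := by
    rw [delbar_conj (h.differentiableAt _ _ (by omega) z), h.del_eq s r (by omega) z]
    simp
  del_top z := by
    rw [del_conj (h.differentiableAt _ _ (by omega) z), h.delbar_bot, map_mul, conj_LL]
  delbar_bot z := by
    rw [delbar_conj (h.differentiableAt _ _ (by omega) z), h.del_top, map_mul, conj_LL]

/-- Since (z - z̄) ∂𝕃/∂z = 𝕃, one has ∂_r 𝕃 = (r+1) 𝕃 for every r, and likewise for ∂̄. This family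
accounts for the constant term a_0(f), which the primitives f^{(k)} omit. -/
lemma isPrimitiveSystem_LL (n : ℕ) :
    IsPrimitiveSystem n (fun _ _ => LL) (fun _ => (n : ℂ) + 1) (fun _ => (n : ℂ) + 1) := by
  have hdel : ∀ (r : ℕ) (z : ℍ), del r LL z = ((r : ℂ) + 1) * LL z := fun r z => by
    rw [(hasWirtingerAt_LL z).del_eq, LL_eq]
    push_cast
    ring
  have hdelbar : ∀ (r : ℕ) (z : ℍ), delbar r LL z = ((r : ℂ) + 1) * LL z := fun r z => by
    rw [(hasWirtingerAt_LL z).delbar_eq, LL_eq]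
    push_cast
    ring
  exact
    { differentiableAt := fun _ _ _ z => HasFDerivAt.differentiableAt (hasWirtingerAt_LL z)
      del_eq := fun r _ _ z => hdel r z
      delbar_eq := fun _ s _ z => hdelbar s z
      del_top := fun z => (hdel n z).trans (mul_comm _ _)
      delbar_bot := fun z => (hdelbar n z).trans (mul_comm _ _) }

/-! ### The system `R_{r,s}(f)` -/

variable {w : ℤ}

/-- `(-1)^k k! 𝕃^{-k} f^{(k+1)}`. -/
def scaledPrimitive (f : WeaklyHolomorphicForm w) (k : ℕ) (z : ℍ) : ℂ :=
  (-1) ^ k * (k.factorial : ℂ) * LL z ^ (-(k : ℤ)) * iteratedPrimitive f (k + 1) z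

lemma R_eq_sum_range (r s : ℕ) (f : WeaklyHolomorphicForm w) (z : ℍ) :
    R r s f z = (-1) ^ r * ((r + s).choose r : ℂ) *
      ∑ j ∈ Finset.range (r + 1), (r.choose j : ℂ) * scaledPrimitive f (s + j) z := by
  rw [R, show Finset.Icc s (r + s) = Finset.Ico s (r + s + 1) by ext; simp,
    Finset.sum_Ico_eq_sum_range, show r + s + 1 - s = r + 1 by omega]
  congr 1
  refine Finset.sum_congr rfl fun j _ => ?_
  rw [Nat.add_sub_cancel_left, scaledPrimitive, zpow_neg, zpow_natCast]
  ring

/-- The denominators match the factors in ∂ and ∂̄: with φ_k the scaled primitive, (z̄ - z)∂̄φ_k =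
-kφ_k, while (z - z̄)∂φ_k has a second term, coming from the derivative of f^{(k+1)}. -/
lemma hasWirtingerAt_scaledPrimitive (f : WeaklyHolomorphicForm w) (k : ℕ) (z : ℍ) :
    HasWirtingerAt (scaledPrimitive f k ∘ ofComplex)
      ((-(k * scaledPrimitive f k z) +
        (-1) ^ k * (k.factorial : ℂ) * LL z ^ (-(k : ℤ)) * LL z * iteratedPrimitive f k z) /
          ((z : ℂ) - conj (z : ℂ)))
      (-(k * scaledPrimitive f k z) / (conj (z : ℂ) - z)) z := by
  have hz := sub_conj_ne_zero z
  have hz' : conj (z : ℂ) - (z : ℂ) ≠ 0 := fun h => hz (by linear_combination -h)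
  have hL := LL_ne_zero z
  have hLz : (LL ∘ ofComplex) (z : ℂ) = LL z := by simp
  have h1 : HasWirtingerAt (fun x => (LL ∘ ofComplex) x ^ (-(k : ℤ))) _ _ (z : ℂ) :=
    HasWirtingerAt.comp_hasDerivAt (g := fun x => x ^ (-(k : ℤ)))
      (hasDerivAt_zpow (-(k : ℤ)) _ (Or.inl (by rwa [hLz]))) (hasWirtingerAt_LL z)
  have h2 := ((h1.const_mul ((-1) ^ k * (k.factorial : ℂ))).mul
    (.of_hasDerivAt (hasDerivAt_iteratedPrimitive f k z)))
  refine h2.congr_deriv ?_ ?_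
  · rw [eq_div_iff hz]
    simp only [Function.comp_apply, ofComplex_apply, scaledPrimitive, zpow_sub_one₀ hL]
    field_simp
    rw [LL_eq]
    push_cast
    ring
  · rw [eq_div_iff hz']
    simp only [Function.comp_apply, ofComplex_apply, scaledPrimitive, zpow_sub_one₀ hL]
    field_simp
    rw [LL_eq]
    push_cast
    ring

lemma hasWirtingerAt_R (r s : ℕ) (f : WeaklyHolomorphicForm w) (z : ℍ) :
    HasWirtingerAt (R r s f ∘ ofComplex)
      ((-1) ^ r * ((r + s).choose r : ℂ) * ∑ j ∈ Finset.range (r + 1), (r.choose j : ℂ) *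
        ((-((s + j : ℕ) * scaledPrimitive f (s + j) z) +
          (-1) ^ (s + j) * ((s + j).factorial : ℂ) * LL z ^ (-((s + j : ℕ) : ℤ)) * LL z *
            iteratedPrimitive f (s + j) z) / ((z : ℂ) - conj (z : ℂ))))
      ((-1) ^ r * ((r + s).choose r : ℂ) * ∑ j ∈ Finset.range (r + 1), (r.choose j : ℂ) *
        (-((s + j : ℕ) * scaledPrimitive f (s + j) z) / (conj (z : ℂ) - z))) z := by
  have h := (HasWirtingerAt.sum (Finset.range (r + 1)) fun j _ =>
    (hasWirtingerAt_scaledPrimitive f (s + j) z).const_mul (r.choose j : ℂ)).const_mul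
      ((-1) ^ r * ((r + s).choose r : ℂ))
  refine h.congr_of_eventuallyEq (.of_forall fun x => ?_)
  simp [R_eq_sum_range]

lemma del_R (r s : ℕ) (f : WeaklyHolomorphicForm w) (z : ℍ) (t : ℤ) :
    del t (R r s f) z = (-1) ^ r * ((r + s).choose r : ℂ) * ∑ j ∈ Finset.range (r + 1),
      (r.choose j : ℂ) * ((t - (s + j : ℕ)) * scaledPrimitive f (s + j) z +
          (-1) ^ (s + j) * ((s + j).factorial : ℂ) * LL z ^ (-((s + j : ℕ) : ℤ)) * LL z *
            iteratedPrimitive f (s + j) z) := by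
  have hz := sub_conj_ne_zero z
  rw [(hasWirtingerAt_R r s f z).del_eq, R_eq_sum_range, mul_left_comm, mul_left_comm (t : ℂ),
    ← mul_add, Finset.mul_sum, Finset.mul_sum, ← Finset.sum_add_distrib]
  congr 1
  refine Finset.sum_congr rfl fun j _ => ?_
  field_simp
  ring

lemma delbar_R (r s : ℕ) (f : WeaklyHolomorphicForm w) (z : ℍ) (t : ℤ) :
    delbar t (R r s f) z = (-1) ^ r * ((r + s).choose r : ℂ) * ∑ j ∈ Finset.range (r + 1),
      (r.choose j : ℂ) * ((t - (s + j : ℕ)) * scaledPrimitive f (s + j) z) := by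
  have hz : conj (z : ℂ) - (z : ℂ) ≠ 0 := fun h => sub_conj_ne_zero z (by linear_combination -h)
  rw [(hasWirtingerAt_R r s f z).delbar_eq, R_eq_sum_range, mul_left_comm, mul_left_comm (t : ℂ),
    ← mul_add, Finset.mul_sum, Finset.mul_sum, ← Finset.sum_add_distrib]
  congr 1
  refine Finset.sum_congr rfl fun j _ => ?_
  field_simp
  ring

/-- Identifies that second term: (z - z̄)∂φ_{k+1} = -(k+1)(φ_{k+1} + φ_k). -/
lemma scaledPrimitive_lower_succ (f : WeaklyHolomorphicForm w) (k : ℕ) (z : ℍ) :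
    (-1) ^ (k + 1) * ((k + 1).factorial : ℂ) * LL z ^ (-((k + 1 : ℕ) : ℤ)) * LL z *
      iteratedPrimitive f (k + 1) z = -((k + 1 : ℕ) * scaledPrimitive f k z) := by
  have hL := LL_ne_zero z
  rw [scaledPrimitive, Nat.factorial_succ, show (-((k + 1 : ℕ) : ℤ)) = -(k : ℤ) - 1 by
    push_cast; ring, zpow_sub_one₀ hL]
  field_simp
  push_cast
  ring

lemma choose_succ_mul_cast (r j : ℕ) :
    (r.choose (j + 1) : ℂ) * ((j : ℂ) + 1) = r.choose j * ((r : ℂ) - j) := by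
  rcases le_or_gt j r with h | h
  · have := Nat.choose_succ_right_eq r j
    rw [← Nat.cast_sub h]
    exact_mod_cast this
  · rw [Nat.choose_eq_zero_of_lt h, Nat.choose_eq_zero_of_lt (h.trans (Nat.lt_succ_self j))]
    simp

/-- Shift j by one and use (j+1) C(r, j+1) = (r-j) C(r, j). This removes the index-dependent
coefficients when ∂ is applied to R_{r,s}(f). -/
lemma sum_choose_mul_index (r : ℕ) (φ : ℕ → ℂ) :
    ∑ j ∈ Finset.range (r + 1), (r.choose j : ℂ) * (j * φ j) =
      ∑ j ∈ Finset.range (r + 1), (r.choose j : ℂ) * (((r : ℂ) - j) * φ (j + 1)) := by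
  rw [Finset.sum_range_succ', Finset.sum_range_succ _ r]
  simp only [Nat.cast_zero, zero_mul, mul_zero, add_zero, sub_self]
  refine Finset.sum_congr rfl fun j _ => ?_
  push_cast
  linear_combination φ (j + 1) * choose_succ_mul_cast r j

lemma sum_choose_pascal (r : ℕ) (φ : ℕ → ℂ) :
    ∑ j ∈ Finset.range (r + 2), ((r + 1).choose j : ℂ) * φ j =
      ∑ j ∈ Finset.range (r + 1), (r.choose j : ℂ) * (φ j + φ (j + 1)) := by
  have h : ∑ j ∈ Finset.range (r + 2), (r.choose j : ℂ) * φ j =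
      ∑ j ∈ Finset.range (r + 1), (r.choose j : ℂ) * φ j := by
    rw [Finset.sum_range_succ, Nat.choose_succ_self]
    simp
  simp only [mul_add, Finset.sum_add_distrib]
  rw [← h, Finset.sum_range_succ', Finset.sum_range_succ' (fun j => (r.choose j : ℂ) * φ j)]
  simp only [Nat.choose_succ_succ, Nat.cast_add, add_mul, Finset.sum_add_distrib,
    Nat.choose_zero_right]
  ring

/-- Everything reduces to binomial identities for the φ_k. The constant a_0(f) is subtracted because
the lowest term φ_0 differentiates to f^{(0)} = f - a_0(f). -/
lemma isPrimitiveSystem_R {n : ℕ} (f : WeaklyHolomorphicForm ((n : ℤ) + 2)) :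
    IsPrimitiveSystem n (fun r s => R r s f) (fun z => f.toFun z - f.coeff 0) (fun _ => 0) where
  differentiableAt r s _ z := HasFDerivAt.differentiableAt (hasWirtingerAt_R r s f z)
  del_eq r s hrs z := by
    have hc : ((r : ℂ) + 1) * ((r + 1 + s).choose (r + 1) : ℂ) =
        (s + 1) * ((r + (s + 1)).choose r : ℂ) := by
      rw [show r + 1 + s = r + (s + 1) by ring]
      have := choose_succ_mul_cast (r + (s + 1)) r
      push_cast at this
      linear_combination this
    set φ : ℕ → ℂ := fun j => scaledPrimitive f (s + j) z with hφ
    rw [del_R, R_eq_sum_range, sum_choose_pascal r φ]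
    -- The two sides differ by the sum of C(r, j) ((r-j) φ_{j+1} - j φ_j), which vanishes by
    -- `sum_choose_mul_index`.
    have h : ∑ j ∈ Finset.range (r + 1), (r.choose j : ℂ) *
        (((r : ℤ) - (s + 1 + j : ℕ)) * scaledPrimitive f (s + 1 + j) z +
          (-1) ^ (s + 1 + j) * ((s + 1 + j).factorial : ℂ) * LL z ^ (-((s + 1 + j : ℕ) : ℤ)) *
            LL z * iteratedPrimitive f (s + 1 + j) z) =
        -(s + 1) * ∑ j ∈ Finset.range (r + 1), (r.choose j : ℂ) * (φ j + φ (j + 1)) := by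
      rw [← sub_eq_zero, Finset.mul_sum, ← Finset.sum_sub_distrib,
        ← sub_eq_zero.2 (sum_choose_mul_index r φ).symm, ← Finset.sum_sub_distrib]
      refine Finset.sum_congr rfl fun j _ => ?_
      rw [show s + 1 + j = s + j + 1 by ring, scaledPrimitive_lower_succ]
      simp only [hφ, ← add_assoc]
      push_cast
      ring
    rw [h]
    linear_combination ((-1) ^ r * ∑ j ∈ Finset.range (r + 1),
      (r.choose j : ℂ) * (φ j + φ (j + 1))) * hc
  delbar_eq r s hrs z := by
    have hc : ((s : ℂ) + 1) * ((r + (s + 1)).choose r : ℂ) =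
        (r + 1) * ((r + 1 + s).choose (r + 1) : ℂ) := by
      rw [show r + 1 + s = r + (s + 1) by ring]
      have := choose_succ_mul_cast (r + (s + 1)) r
      push_cast at this
      linear_combination -this
    set φ : ℕ → ℂ := fun j => scaledPrimitive f (s + j) z with hφ
    have h : ∑ j ∈ Finset.range (r + 1 + 1), ((r + 1).choose j : ℂ) *
        (((s : ℤ) - (s + j : ℕ)) * φ j) =
        -(r + 1) * ∑ j ∈ Finset.range (r + 1), (r.choose j : ℂ) * φ (j + 1) := by
      rw [Finset.sum_range_succ', Finset.mul_sum]
      simp only [add_zero, Int.cast_natCast, sub_self, zero_mul, mul_zero]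
      refine Finset.sum_congr rfl fun j _ => ?_
      have hj : ((r : ℂ) + 1) * r.choose j = (r + 1).choose (j + 1) * (j + 1) := by
        exact_mod_cast Nat.add_one_mul_choose_eq r j
      push_cast
      linear_combination φ (j + 1) * hj
    rw [delbar_R, R_eq_sum_range, h]
    simp only [hφ, add_right_comm s 1, ← add_assoc]
    rw [← add_assoc] at hc
    linear_combination (-(-1) ^ r * ∑ j ∈ Finset.range (r + 1),
      (r.choose j : ℂ) * scaledPrimitive f (s + j + 1) z) * hc
  del_top z := by
    have h : ∑ j ∈ Finset.range (n + 1), (n.choose j : ℂ) *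
        (((n : ℤ) - (0 + j : ℕ)) * scaledPrimitive f (0 + j) z +
          (-1) ^ (0 + j) * ((0 + j).factorial : ℂ) * LL z ^ (-((0 + j : ℕ) : ℤ)) *
            LL z * iteratedPrimitive f (0 + j) z) = LL z * (f.toFun z - f.coeff 0) := by
      -- At j = 0 the truncated j - 1 is harmless, since it is multiplied by j. All terms then
      -- cancel except the lowest, 𝕃 f^{(0)}.
      have h1 := sum_choose_mul_index n fun j => scaledPrimitive f (j - 1) z
      simp only [Nat.add_sub_cancel] at h1
      simp only [zero_add, mul_add, Finset.sum_add_distrib, Int.cast_natCast]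
      rw [← h1, ← Finset.sum_add_distrib, Finset.sum_range_succ']
      rw [Finset.sum_eq_zero fun j _ => ?_]
      · simp [iteratedPrimitive_zero]
      · rw [scaledPrimitive_lower_succ, Nat.add_sub_cancel]
        ring
    rw [del_R, h]
    -- The definition of R leaves a factor (-1)^n; for odd n both f and a_0(f) vanish.
    rcases Nat.even_or_odd n with hn | hn
    · simp [hn.neg_one_pow]
    · have hf := toFun_eq_zero_of_odd hn f
      simp [hf z, coeff_zero_eq_zero hf]
  delbar_bot z := by
    rw [delbar_R]
    simp

/-! ### Sections over the translation-invariant functions -/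

/-- For `a ≠ b`, the polynomials `(X - a)^r (X - b)^s` with `r + s = n` are linearly
independent. -/
lemma eq_zero_of_sum_sub_pow_mul_sub_pow {n : ℕ} {a b : ℂ} (hab : a ≠ b) {c : ℕ → ℕ → ℂ}
    (h : ∀ X : ℂ, ∑ p ∈ Finset.HasAntidiagonal.antidiagonal n,
      c p.1 p.2 * (X - a) ^ p.1 * (X - b) ^ p.2 = 0) {r s : ℕ} (hrs : r + s = n) :
    c r s = 0 := by
  set Q : Polynomial ℂ := ∑ p ∈ Finset.HasAntidiagonal.antidiagonal n,
    Polynomial.C (c p.1 p.2) * Polynomial.X ^ p.1 with hQ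
  have hQ0 : Q = 0 := by
    refine Q.eq_zero_of_infinite_isRoot
      ((Set.finite_singleton (1 : ℂ)).infinite_compl.mono fun t ht => ?_)
    have ht1 : 1 - t ≠ 0 := sub_ne_zero.2 (Ne.symm ht)
    -- This X is the point where (X - a)/(X - b) = t.
    have hX := h ((a - t * b) / (1 - t))
    have ha : (a - t * b) / (1 - t) - a = t * ((a - b) / (1 - t)) := by
      field_simp
      ring
    have hb : (a - t * b) / (1 - t) - b = (a - b) / (1 - t) := by
      field_simp
      ring
    have hne : ((a - b) / (1 - t)) ^ n ≠ 0 :=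
      pow_ne_zero _ (div_ne_zero (sub_ne_zero.2 hab) ht1)
    rw [ha, hb] at hX
    apply mul_left_cancel₀ hne
    rw [mul_zero, ← hX, hQ, Polynomial.eval_finsetSum, Finset.mul_sum]
    refine Finset.sum_congr rfl fun p hp => ?_
    rw [← Finset.HasAntidiagonal.mem_antidiagonal.1 hp, pow_add, mul_pow]
    simp only [Polynomial.eval_mul, Polynomial.eval_C, Polynomial.eval_pow, Polynomial.eval_X]
    ring
  have hcoeff : Q.coeff r = c r s := by
    rw [hQ, Polynomial.finsetSum_coeff, Finset.sum_eq_single (r, s)]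
    · simp
    · rintro ⟨r', s'⟩ hp hne
      have hp' := Finset.HasAntidiagonal.mem_antidiagonal.1 hp
      rw [Polynomial.coeff_C_mul_X_pow, if_neg]
      rintro rfl
      exact hne (by simp only [Prod.mk.injEq, true_and]; simp only at hp'; omega)
    · intro hn
      exact absurd (Finset.HasAntidiagonal.mem_antidiagonal.2 hrs) hn
  rw [← hcoeff, hQ0, Polynomial.coeff_zero]

/-- A periodic polynomial takes the value Q(0) at every natural number. -/
lemma polynomial_eq_C_of_periodic {Q : Polynomial ℂ} (h : ∀ x, Q.eval (x + 1) = Q.eval x) :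
    Q = Polynomial.C (Q.eval 0) := by
  have hnat : ∀ m : ℕ, Q.eval (m : ℂ) = Q.eval 0 := fun m => by
    induction m with
    | zero => simp
    | succ m ih => rw [Nat.cast_succ, h, ih]
  rw [← sub_eq_zero]
  refine Polynomial.eq_zero_of_infinite_isRoot _
    ((Set.infinite_range_of_injective (Nat.cast_injective (R := ℂ))).mono ?_)
  rintro _ ⟨m, rfl⟩
  simp [hnat]

/-- A translation-invariant system whose section `S` satisfies `dS = e (X - z̄Y)^n dz̄` has `e = 0`,
and its section is a multiple of `Y^n`. -/
lemma exists_eq_mul_LL_zpow_of_periodic {n : ℕ} {G : ℕ → ℕ → ℍ → ℂ} {e : ℂ}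
    (hper : ∀ r s : ℕ, r + s = n → ∀ z : ℍ, G r s ((1 : ℝ) +ᵥ z) = G r s z)
    (hG : ∀ (X Y : ℂ) (z : ℍ),
      HasWirtingerAt (vectorSection n G X Y) 0 (e * (X - conj (z : ℂ) * Y) ^ n) z) :
    e = 0 ∧ ∃ α : ℂ, ∀ r s : ℕ, r + s = n → ∀ z : ℍ,
      G r s z = α * (-1) ^ r * (n.choose r : ℂ) * LL z ^ (-(n : ℤ)) := by
  have hn1 : (n : ℂ) + 1 ≠ 0 := Nat.cast_add_one_ne_zero n
  set c := e / ((n : ℂ) + 1) with hc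
  -- The second term is chosen so that its z̄-derivative cancels e (X - z̄)^n; hence K does not
  -- depend on z.
  let K : ℂ → ℂ → ℂ := fun X z => vectorSection n G X 1 z + c * (X - conj z) ^ (n + 1)
  have hK : ∀ (X : ℂ) (z w : ℍ), K X z = K X w := fun X => by
    refine eq_of_hasWirtingerAt_zero fun z => ?_
    have hid : HasWirtingerAt (fun w => w) 1 0 (z : ℂ) := .of_hasDerivAt (hasDerivAt_id _)
    have hv := (((HasWirtingerAt.const X).sub hid.conjugate).pow (n + 1)).const_mul c
    refine ((hG X 1 z).add hv).congr_deriv (by simp) ?_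
    rw [hc]
    simp only [mul_one, map_one, zero_sub, Nat.add_sub_cancel]
    push_cast
    field_simp
    ring
  have hsec : ∀ (X : ℂ) (z : ℍ), vectorSection n G X 1 z =
      ∑ p ∈ Finset.HasAntidiagonal.antidiagonal n,
        G p.1 p.2 z * (X - z) ^ p.1 * (X - conj (z : ℂ)) ^ p.2 := fun X z => by
    simp [vectorSection]
  -- X - z and X - z̄ are unchanged when X and z both move by 1, and z may be moved freely.
  have hshift : ∀ (X : ℂ) (z : ℍ), K (X + 1) z = K X z := fun X z => by
    rw [hK (X + 1) z ((1 : ℝ) +ᵥ z)]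
    have h1 : X + 1 - (((1 : ℝ) +ᵥ z : ℍ) : ℂ) = X - z := by
      rw [coe_vadd, ofReal_one]
      ring
    have h2 : X + 1 - conj (((1 : ℝ) +ᵥ z : ℍ) : ℂ) = X - conj (z : ℂ) := by
      rw [coe_vadd, ofReal_one, map_add, map_one]
      ring
    simp only [K, hsec, h1, h2]
    congr 1
    exact Finset.sum_congr rfl fun p hp => by
      rw [hper p.1 p.2 (Finset.HasAntidiagonal.mem_antidiagonal.1 hp)]
  let Q : ℍ → Polynomial ℂ := fun z => ∑ p ∈ Finset.HasAntidiagonal.antidiagonal n,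
    Polynomial.C (G p.1 p.2 z) * (Polynomial.X - Polynomial.C (z : ℂ)) ^ p.1 *
      (Polynomial.X - Polynomial.C (conj (z : ℂ))) ^ p.2
  let P : ℍ → Polynomial ℂ := fun z =>
    (Polynomial.X - Polynomial.C (conj (z : ℂ))) ^ (n + 1)
  have heval : ∀ (z : ℍ) (X : ℂ), (Q z + Polynomial.C c * P z).eval X = K X z := fun z X => by
    simp [Q, P, K, hsec, Polynomial.eval_finsetSum]
  have hconst : ∀ z : ℍ, Q z + Polynomial.C c * P z = Polynomial.C (K 0 z) := fun z => by
    rw [← heval z 0]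
    refine polynomial_eq_C_of_periodic fun X => ?_
    rw [heval, heval, hshift]
  have hQdeg : ∀ z : ℍ, (Q z).natDegree ≤ n := fun z => by
    refine Polynomial.natDegree_sum_le_of_forall_le _ _ fun p hp => ?_
    have hp' := Finset.HasAntidiagonal.mem_antidiagonal.1 hp
    refine (Polynomial.natDegree_mul_le_of_le (Polynomial.natDegree_mul_le_of_le
      (Polynomial.natDegree_C _).le (Polynomial.natDegree_pow_le_of_le p.1
        (Polynomial.natDegree_X_sub_C_le _))) (Polynomial.natDegree_pow_le_of_le p.2
        (Polynomial.natDegree_X_sub_C_le _))).trans ?_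
    omega
  -- In degree n + 1 the section contributes nothing and the monic power contributes c.
  have hc0 : c = 0 := by
    let z := UpperHalfPlane.I
    have h := congrArg (fun T => Polynomial.coeff T (n + 1)) (hconst z)
    have hP : (P z).coeff (n + 1) = 1 := by
      have hm : (P z).Monic := (Polynomial.monic_X_sub_C _).pow (n + 1)
      have hd : (P z).natDegree = n + 1 := by simp [P]
      rw [← hd]
      exact hm
    simp only [Polynomial.coeff_add, Polynomial.coeff_C_mul, hP,
      Polynomial.coeff_eq_zero_of_natDegree_lt (Nat.lt_succ_of_le (hQdeg z)),
      Polynomial.coeff_C_succ] at h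
    simpa using h
  -- The factor (πi)^n converts (z - z̄)^{-n} into 𝕃^{-n}.
  refine ⟨by rwa [hc, div_eq_zero_iff, or_iff_left hn1] at hc0,
    K 0 UpperHalfPlane.I * (Real.pi * I) ^ n, fun r s hrs z => ?_⟩
  have hz := sub_conj_ne_zero z
  rw [← sub_eq_zero]
  refine eq_zero_of_sum_sub_pow_mul_sub_pow (a := z) (b := conj (z : ℂ))
    (n := n) (c := fun r s => G r s z - K 0 UpperHalfPlane.I * (Real.pi * I) ^ n * (-1) ^ r *
      (n.choose r : ℂ) * LL z ^ (-(n : ℤ))) (sub_ne_zero.1 hz) (fun X => ?_) hrs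
  have h1 : ∑ p ∈ Finset.HasAntidiagonal.antidiagonal n,
      G p.1 p.2 z * (X - z) ^ p.1 * (X - conj (z : ℂ)) ^ p.2 = K 0 UpperHalfPlane.I := by
    have := congrArg (Polynomial.eval X) (hconst z)
    rw [heval, Polynomial.eval_C, hK 0 z UpperHalfPlane.I] at this
    rw [← this]
    simp [K, hsec, hc0]
  have h2 := (Commute.all (-(X - (z : ℂ))) (X - conj (z : ℂ))).add_pow' n
  rw [show -(X - (z : ℂ)) + (X - conj (z : ℂ)) = z - conj (z : ℂ) by ring] at h2
  have h3 : ((z : ℂ) - conj (z : ℂ)) ^ n * ((Real.pi * I) ^ n * LL z ^ (-(n : ℤ))) = 1 := by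
    rw [← mul_assoc, ← mul_pow, mul_comm ((z : ℂ) - _), ← LL_eq, zpow_neg, zpow_natCast,
      mul_inv_cancel₀ (pow_ne_zero _ (LL_ne_zero z))]
  calc _ = K 0 UpperHalfPlane.I - K 0 UpperHalfPlane.I * (((z : ℂ) - conj (z : ℂ)) ^ n *
        ((Real.pi * I) ^ n * LL z ^ (-(n : ℤ)))) := by
        rw [h2, Finset.sum_mul, Finset.mul_sum, ← h1, ← Finset.sum_sub_distrib]
        refine Finset.sum_congr rfl fun p _ => ?_
        rw [h1, nsmul_eq_mul, neg_pow (X - (z : ℂ))]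
        ring
    _ = 0 := by rw [h3]; ring

/-- The translation-invariant systems whose section `S` satisfies
`dS = πi f (X - zY)^n dz - πi ε ḡ (X - z̄Y)^n dz̄`. -/
lemma coeff_zero_eq_and_existsUnique {n : ℕ} {f g : WeaklyHolomorphicForm ((n : ℤ) + 2)} {ε : ℂ}
    {H : ℕ → ℕ → ℍ → ℂ}
    (hper : ∀ r s : ℕ, r + s = n → ∀ z : ℍ, H r s ((1 : ℝ) +ᵥ z) = H r s z)
    (hH : ∀ (X Y : ℂ) (z : ℍ), HasWirtingerAt (vectorSection n H X Y)
      (Real.pi * I * f.toFun z * (X - (z : ℂ) * Y) ^ n)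
      (-(Real.pi * I * (ε * conj (g.toFun z)) * (X - conj (z : ℂ) * Y) ^ n)) z) :
    f.coeff 0 = ε * conj (g.coeff 0) ∧ ∃! α : ℂ, ∀ r s : ℕ, r + s = n → ∀ z : ℍ,
      H r s z = f.coeff 0 / ((n : ℂ) + 1) * LL z
        + α * (-1) ^ r * (n.choose r : ℂ) * LL z ^ (-(n : ℤ))
        + R r s f z + ε * conj (R s r g z) := by
  have hn1 : (n : ℂ) + 1 ≠ 0 := Nat.cast_add_one_ne_zero n
  have hpi : (Real.pi * I : ℂ) ≠ 0 := by simp [Real.pi_ne_zero]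
  let G : ℕ → ℕ → ℍ → ℂ := fun r s z =>
    H r s z - (f.coeff 0 / ((n : ℂ) + 1) * LL z + R r s f z + ε * conj (R s r g z))
  have hsec : ∀ X Y x : ℂ, vectorSection n G X Y x = vectorSection n H X Y x -
      (f.coeff 0 / ((n : ℂ) + 1) * vectorSection n (fun _ _ => LL) X Y x +
        vectorSection n (fun r s => R r s f) X Y x +
        ε * vectorSection n (fun r s z => conj (R s r g z)) X Y x) := fun X Y x => by
    simp only [vectorSection, Finset.mul_sum, ← Finset.sum_add_distrib, ← Finset.sum_sub_distrib]
    refine Finset.sum_congr rfl fun p _ => ?_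
    simp only [G]
    ring
  obtain ⟨he, α, hα⟩ := exists_eq_mul_LL_zpow_of_periodic (G := G) (n := n)
    (e := Real.pi * I * (f.coeff 0 - ε * conj (g.coeff 0)))
    (fun r s hrs z => by simp only [G, hper r s hrs, LL_vadd_one, R_vadd_one])
    (fun X Y z => by
      refine (((hH X Y z).sub
        (((((isPrimitiveSystem_LL n).hasWirtingerAt_vectorSection X Y z).const_mul
            (f.coeff 0 / ((n : ℂ) + 1))).add
          ((isPrimitiveSystem_R f).hasWirtingerAt_vectorSection X Y z)).add
        (((isPrimitiveSystem_R g).conjugate.hasWirtingerAt_vectorSection X Y z).const_mul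
          ε))).congr_deriv ?_ ?_).congr_of_eventuallyEq (.of_forall (hsec X Y))
      · rw [map_zero]
        field_simp
        ring
      · rw [map_sub]
        field_simp
        ring)
  refine ⟨sub_eq_zero.1 ((mul_eq_zero.1 he).resolve_left hpi), α, fun r s hrs z => ?_,
    fun β hβ => ?_⟩
  · have h := hα r s hrs z
    simp only [G] at h
    linear_combination h
  -- For uniqueness, compare at (r, s) = (n, 0) and z = i, where the coefficient of α is nonzero.
  · have h1 := hα n 0 (add_zero n) UpperHalfPlane.I
    have h2 := hβ n 0 (add_zero n) UpperHalfPlane.I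
    have hne : (-1 : ℂ) ^ n * LL UpperHalfPlane.I ^ (-(n : ℤ)) ≠ 0 :=
      mul_ne_zero (pow_ne_zero _ (by simp)) (zpow_ne_zero _ (LL_ne_zero _))
    simp only [G, Nat.choose_self, Nat.cast_one] at h1 h2
    exact mul_right_cancel₀ hne (by linear_combination h1 - h2)

end RealAnalyticModular

end

theorem theorem2 (n : ℕ) :
    (∀ (f sf : RealAnalyticModular.WeaklyHolomorphicForm ((n : ℤ) + 2)) (H : ℕ → ℕ → ℍ → ℂ),
      RealAnalyticModular.IsRealAnalyticCuspForm n f sf H →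
        ∃! α : ℂ, ∀ r s : ℕ, r + s = n → ∀ z : ℍ,
          H r s z =
            f.coeff 0 / ((n : ℂ) + 1) * RealAnalyticModular.LL z
            + α * (-1) ^ r * (n.choose r : ℂ) * RealAnalyticModular.LL z ^ (-(n : ℤ))
            + RealAnalyticModular.R r s f z
            - conj (RealAnalyticModular.R s r sf z)) ∧
    (∀ (f g : RealAnalyticModular.WeaklyHolomorphicForm ((n : ℤ) + 2)) (X : ℕ → ℕ → ℍ → ℂ),
      RealAnalyticModular.IsModularPrimitiveSystem n f g X →
        f.coeff 0 = conj (g.coeff 0) ∧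
        ∃! α : ℂ, ∀ r s : ℕ, r + s = n → ∀ z : ℍ,
          X r s z =
            f.coeff 0 / ((n : ℂ) + 1) * RealAnalyticModular.LL z
            + α * (-1) ^ r * (n.choose r : ℂ) * RealAnalyticModular.LL z ^ (-(n : ℤ))
            + RealAnalyticModular.R r s f z
            + conj (RealAnalyticModular.R s r g z)) := by
  open RealAnalyticModular in
  refine ⟨fun f sf H h => ?_, fun f g X h => ?_⟩
  · have hH := (coeff_zero_eq_and_existsUnique (f := f) (g := sf) (ε := -1) (H := H)
      (fun r s hrs z => (h.mem r s hrs).modular.vadd_one z) (fun X Y z => by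
        -- The hypotheses give only the values of `dz` and `dzbar`; real analyticity of the
        -- components makes the section differentiable, so these values determine its differential.
        have hd := hasWirtingerAt_vectorSection_of_differentiableAt (z := z)
          (fun r s hrs => ((h.mem r s hrs).analytic z z.im_pos).differentiableAt) X Y
        have h1 := hd.dz_eq
        have h2 := hd.dzbar_eq
        rw [h.dz_eq] at h1
        rw [h.dzbar_eq] at h2
        refine hd.congr_deriv h1.symm ?_
        rw [← h2]
        ring)).2
    simpa only [neg_one_mul, ← sub_eq_add_neg] using hH
  · have hsys : IsPrimitiveSystem n X f.toFun (fun z => (starRingEnd ℂ) (g.toFun z)) :=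
      { differentiableAt := fun r s hrs z =>
          ((h.mem r s hrs).analytic z z.im_pos).differentiableAt
        del_eq := h.del_eq
        delbar_eq := h.delbar_eq
        del_top := h.del_top
        delbar_bot := h.delbar_bot }
    have hX := coeff_zero_eq_and_existsUnique (f := f) (g := g) (ε := 1) (H := X)
      (fun r s hrs z => (h.mem r s hrs).modular.vadd_one z) (fun A B z => by
        simpa only [one_mul] using hsys.hasWirtingerAt_vectorSection A B z)
    simpa only [one_mul] using hX
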